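/- Let $\mathcal H$ be a complex Hilbert space and $S$ a densely defined symmetric operator in $\mathcal H$ with closure $\overline S$ and adjoint $S^*$. Assume that $0$ is a point of regular type of $\overline S$, i.e. there is $c>0$ with $\|\overline S f\|\ge c\|f\|$ for all $f\in\mathcal D(\overline S)$, and that $\ker S^*\neq\{0\}$. Let $S_{\mathrm D}$ be a self-adjoint extension of $S$ with everywhere defined bounded inverse $S_{\mathrm D}^{-1}$, and let $\widetilde S$ be a self-adjoint extension of $S$. Let $P_W$ denote the orthogonal projection onto a closed subspace $W$. For every $\varepsilon>0$ there is a unique unitary $U_\varepsilon:\ker(S^*-\mathrm i\varepsilon)\to\ker(S^*+\mathrm i\varepsilon)$ such that $$\mathcal D(\widetilde S)=\{f_\varepsilon+u_\varepsilon-U_\varepsilon u_\varepsilon \mid f_\varepsilon\in\mathcal D(\overline S),\ u_\varepsilon\in\ker(S^*-\mathrm i\varepsilon)\},\qquad \widetilde S(f_\varepsilon+u_\varepsilon-U_\varepsilon u_\varepsilon)=\overline S f_\varepsilon+\mathrm i\varepsilon u_\varepsilon+\mathrm i\varepsilon U_\varepsilon u_\varepsilon ,$$ and there is a unique operator $T$,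 self-adjoint in some closed subspace of $\ker S^*$, such that $$\mathcal D(\widetilde S)=\{f+S_{\mathrm D}^{-1}(Tu+w)+u \mid f\in\mathcal D(\overline S),\ u\in\mathcal D(T),\ w\in\ker S^*\cap\mathcal D(T)^\perp\},\qquad \widetilde S(f+S_{\mathrm D}^{-1}(Tu+w)+u)=\overline S f+Tu+w .$$ Every $g\in\mathcal D(\widetilde S)$ can be written as $$f+S_{\mathrm D}^{-1}(Tu+w)+u=g=f_\varepsilon+u_\varepsilon-U_\varepsilon u_\varepsilon\qquad(\varepsilon>0)$$ with components $f,f_\varepsilon\in\mathcal D(\overline S)$, $u\in\mathcal D(T)$, $w\in\ker S^*\cap\mathcal D(T)^\perp$, $u_\varepsilon\in\ker(S^*-\mathrm i\varepsilon)$ in the above spaces, which are uniquely determined by $g$, and \begin{align*} u_\varepsilon&=(2\mathrm i\varepsilon)^{-1}P_{\ker(S^*-\mathrm i\varepsilon)}(\widetilde S+\mathrm i\varepsilon)g, & U_\varepsilon u_\varepsilon&=(2\mathrm i\varepsilon)^{-1}P_{\ker(S^*+\mathrm i\varepsilon)}(\widetilde S-\mathrm i\varepsilon)g,\\ u&=(1-S_{\mathrm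 D}^{-1}\widetilde S)g, & f&=S_{\mathrm D}^{-1}(1-P_{\ker S^*})\widetilde S g,\\ Tu+w&=P_{\ker S^*}\widetilde S g . \end{align*} Moreover, for each fixed $g$, as $\varepsilon\downarrow0$, in the norm of $\mathcal H$, \begin{align*} (1-S_{\mathrm D}^{-1}S^*)(u_\varepsilon-U_\varepsilon u_\varepsilon)&=u+O(\varepsilon),\\ 2\mathrm i\varepsilon u_\varepsilon&=Tu+w+O(\varepsilon),\\ 2\mathrm i\varepsilon U_\varepsilon u_\varepsilon&=Tu+w+O(\varepsilon),\\ u_\varepsilon-U_\varepsilon u_\varepsilon&=S_{\mathrm D}^{-1}(Tu+w)+u+O(\varepsilon),\\ \mathrm i\varepsilon u_\varepsilon+\mathrm i\varepsilon U_\varepsilon u_\varepsilon&=Tu+w+O(\varepsilon),\\ f_\varepsilon&=f+O(\varepsilon),\\ \overline S f_\varepsilon&=\overline S f+O(\varepsilon). \end{align*} Finally, $u_\varepsilon-U_\varepsilon u_\varepsilon=S_{\mathrm D}^{-1}(Tu+w)+u+O(\varepsilon)$ and $f_\varepsilon=f+O(\varepsilon)$ hold also in the graph norm $(\|x\|^2+\|\widetilde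 S x\|^2)^{1/2}$ of $\widetilde S$ (all vectors involved belonging to $\mathcal D(\widetilde S)$), and likewise in the graph norm of $S^*$. -/

import Mathlib

open scoped LinearPMap Topology
open Filter Asymptotics

noncomputable section

namespace ExtensionTheory

variable {H : Type*} [NormedAddCommGroup H] [InnerProductSpace ℂ H]

/-- `z` is a point of regular type of `A`: the operator `A - z` is injective with bounded inverse,
the inverse being defined on the range of `A - z`. -/
def IsRegularTypePoint (A : H →ₗ.[ℂ] H) (z : ℂ) : Prop :=
  ∃ c : ℝ, 0 < c ∧ ∀ f : A.domain, c * ‖(f : H)‖ ≤ ‖A f - z • (f : H)‖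

/-- `R` is the everywhere defined bounded inverse of `A`. -/
def IsBoundedInverse (A : H →ₗ.[ℂ] H) (R : H →L[ℂ] H) : Prop :=
  (∀ x : A.domain, R (A x) = x) ∧ ∀ y : H, ∃ h : R y ∈ A.domain, A ⟨R y, h⟩ = y

/-- The graph norm of `A` on its domain. -/
def graphNorm (A : H →ₗ.[ℂ] H) (x : A.domain) : ℝ :=
  √(‖(x : H)‖ ^ 2 + ‖A x‖ ^ 2)

/-- The filter `ε ↓ 0` on the positive reals. -/
def towardsZero : Filter (Set.Ioi (0 : ℝ)) :=
  comap Subtype.val (𝓝[>] (0 : ℝ))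

/-- `x ε = y + O(ε)` as `ε ↓ 0`, in the norm of `H`. -/
def EqAddBigO (x : Set.Ioi (0 : ℝ) → H) (y : H) : Prop :=
  (fun ε => x ε - y) =O[towardsZero] fun ε => (ε : ℝ)

/-- `x ε = y + O(ε)` as `ε ↓ 0`, in the graph norm of `A`;
all the vectors are required to lie in the domain of `A`. -/
def EqAddBigOGraph (A : H →ₗ.[ℂ] H) (x : Set.Ioi (0 : ℝ) → H) (y : H) : Prop :=
  ∃ (hx : ∀ ε, x ε ∈ A.domain) (hy : y ∈ A.domain),
    (fun ε => graphNorm A (⟨x ε, hx ε⟩ - ⟨y, hy⟩)) =O[towardsZero] fun ε => (ε : ℝ)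

/-- `T` is a self-adjoint operator acting in some closed subspace `K` of `N`
(dense domain in `K`, range in `K`, self-adjoint there), regarded as a partial operator of `H`. -/
def IsSelfAdjointInSubspace (N : Submodule ℂ H) (T : H →ₗ.[ℂ] H) : Prop :=
  ∃ (K : Submodule ℂ H) (_ : CompleteSpace K) (A : K →ₗ.[ℂ] K),
    K ≤ N ∧ IsSelfAdjoint A ∧ T.graph = A.graph.map (K.subtype.prodMap K.subtype)

variable [CompleteSpace H]

/-- The space `ker (S* - z)`: all `x` in the domain of `S*` with `S* x = z x`. -/
def deficiencySpace (S : H →ₗ.[ℂ] H) (z : ℂ) : Submodule ℂ H :=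
  S†.graph.comap (LinearMap.id.prod (z • LinearMap.id))

theorem mem_deficiencySpace_iff (S : H →ₗ.[ℂ] H) (z : ℂ) (x : H) :
    x ∈ deficiencySpace S z ↔ ∃ h : x ∈ S†.domain, S† ⟨x, h⟩ = z • x := by
  simp [deficiencySpace, LinearPMap.mem_graph_iff]

theorem deficiencySpace_le_domain (S : H →ₗ.[ℂ] H) (z : ℂ) :
    deficiencySpace S z ≤ S†.domain := fun x hx =>
  ((mem_deficiencySpace_iff S z x).1 hx).1

theorem isClosed_deficiencySpace {S : H →ₗ.[ℂ] H} (hS : Dense (S.domain : Set H)) (z : ℂ) :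
    IsClosed (deficiencySpace S z : Set H) := by
  have h : IsClosed (S†.graph : Set (H × H)) := LinearPMap.adjoint_isClosed hS
  have hc : Continuous fun x : H => (x, z • x) := by fun_prop
  exact h.preimage hc

/-- The orthogonal projection of `H` onto `ker (S* - z)`. -/
def deficiencyProj {S : H →ₗ.[ℂ] H} (hS : Dense (S.domain : Set H)) (z : ℂ) : H →L[ℂ] H :=
  haveI : CompleteSpace (deficiencySpace S z) := (isClosed_deficiencySpace hS z).completeSpace_coe
  (deficiencySpace S z).starProjection

/-- The inclusion of `ker (S* - z)` in the domain of `S*`. -/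
def toAdjointDomain (S : H →ₗ.[ℂ] H) (z : ℂ) : deficiencySpace S z →ₗ[ℂ] S†.domain :=
  Submodule.inclusion (deficiencySpace_le_domain S z)

/-- The graph of the von Neumann extension `S_U` at the spectral point `iε`,
`S_U (f + u - U u) = S̄ f + iε u + iε U u`. -/
def vonNeumannGraph (S : H →ₗ.[ℂ] H) (ε : ℝ)
    (U : deficiencySpace S (Complex.I * ε) ≃ₗᵢ[ℂ] deficiencySpace S (-(Complex.I * ε))) :
    Set (H × H) :=
  {p | ∃ (f : S.closure.domain) (u : deficiencySpace S (Complex.I * ε)),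
    p.1 = f + u - U u ∧
    p.2 = S.closure f + (Complex.I * ε) • (u : H) + (Complex.I * ε) • (U u : H)}

/-- `U` is the von Neumann parameter of the extension `A` of `S` at `iε`, i.e. `A = S_U`. -/
def IsVonNeumannParameter (S A : H →ₗ.[ℂ] H) (ε : ℝ)
    (U : deficiencySpace S (Complex.I * ε) ≃ₗᵢ[ℂ] deficiencySpace S (-(Complex.I * ε))) : Prop :=
  (A.graph : Set (H × H)) = vonNeumannGraph S ε U

/-- The space `ker S* ∩ D(T)ᗮ`. -/
def coDomainSpace (S T : H →ₗ.[ℂ] H) : Submodule ℂ H :=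
  deficiencySpace S 0 ⊓ T.domainᗮ

/-- The graph of the extension `S_T` of `S`, relative to the inverse `R` of the
distinguished extension, `S_T (f + R (T u + w) + u) = S̄ f + T u + w`. -/
def relativeGraph (S : H →ₗ.[ℂ] H) (R : H →L[ℂ] H) (T : H →ₗ.[ℂ] H) : Set (H × H) :=
  {p | ∃ (f : S.closure.domain) (u : T.domain) (w : coDomainSpace S T),
    p.1 = f + R (T u + w) + u ∧ p.2 = S.closure f + T u + w}

/-- `T` is the parameter of the extension `A` of `S` relative to the distinguished extension with
inverse `R`: a self-adjoint operator in a closed subspace of `ker S*` with `A = S_T`. -/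
def IsRelativeParameter (S A : H →ₗ.[ℂ] H) (R : H →L[ℂ] H) (T : H →ₗ.[ℂ] H) : Prop :=
  IsSelfAdjointInSubspace (deficiencySpace S 0) T ∧
    (A.graph : Set (H × H)) = relativeGraph S R T

end ExtensionTheory

end

/-! Write `N` for `ker S*`. The von Neumann parameter is a restriction of the Cayley transform `V =
(A - iε)(A + iε)⁻¹`. This unitary carries `ran (S̄ + iε)` onto `ran (S̄ - iε)`, hence also the
orthogonal complements `ker (S* - iε)` and `ker (S* + iε)` onto each other
(`map_cayley_deficiencySpace`).

For the relative parameter, regularity at `0` gives `Nᗮ = ran S̄`. So `A g = S̄ f + n` with `n ∈ N`,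
while `v = g - R (A g)` lies in `N` because `A` and `SD` are both restrictions of `S*`. Since `R` is
symmetric, the pairs `(v, n)` form a self-adjoint relation in `N` (`boundaryRelation_selfAdjoint`),
and `T` is its operator part (`exists_operatorPart`).

The limits all come from `S̄ f_ε - S̄ f = O(ε)` (`norm_closure_sub_le`). With `d` this difference,
`d = n + iε (g - f_ε) - 2iε u_ε`. In `⟨d, d⟩` the term with `n` vanishes, and moving `S̄` across to
`u_ε`, where `S* u_ε = iε u_ε`, extracts a factor `ε` from the last term. Regularity at `0` then
transfers the bound to `f_ε - f`; the other components are differences with `g` and `A g`. -/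

noncomputable section

namespace ExtensionTheory

/-! ### Regular points, closed ranges and orthogonality to deficiency spaces -/

section Basic

variable {H : Type*} [NormedAddCommGroup H] [InnerProductSpace ℂ H]

/-- The range of `B - z`. -/
def shiftedRange (B : H →ₗ.[ℂ] H) (z : ℂ) : Submodule ℂ H :=
  LinearMap.range (B.toFun - z • B.domain.subtype)

theorem mem_shiftedRange {B : H →ₗ.[ℂ] H} {z : ℂ} {y : H} :
    y ∈ shiftedRange B z ↔ ∃ x : B.domain, B x - z • (x : H) = y :=
  Iff.rfl

theorem sub_smul_mem_shiftedRange (B : H →ₗ.[ℂ] H) (z : ℂ) (x : B.domain) :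
    B x - z • (x : H) ∈ shiftedRange B z :=
  ⟨x, rfl⟩

/-- If `A` extends `B` then the values agree. -/
theorem mem_graph_of_le {B A : H →ₗ.[ℂ] H} (h : B ≤ A) (x : B.domain) :
    ((x : H), B x) ∈ A.graph :=
  LinearPMap.le_graph_of_le h (B.mem_graph x)

theorem apply_eq_of_mem_graph {A : H →ₗ.[ℂ] H} {x y : H} (h : (x, y) ∈ A.graph)
    (hx : x ∈ A.domain) : A ⟨x, hx⟩ = y :=
  A.mem_graph_snd_inj (A.mem_graph ⟨x, hx⟩) h rfl

/-- Seen as a bounded map on the complete space `B.graph`, `B - z` is bounded below, hence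
antilipschitz with closed range. -/
theorem isClosed_shiftedRange [CompleteSpace H] {B : H →ₗ.[ℂ] H} (hB : B.IsClosed) {z : ℂ}
    (hz : IsRegularTypePoint B z) : IsClosed (shiftedRange B z : Set H) := by
  obtain ⟨c, hc, h⟩ := hz
  have hcomplete : CompleteSpace B.graph := IsClosed.completeSpace_coe (hs := hB)
  let φ : B.graph →L[ℂ] H :=
    (ContinuousLinearMap.snd ℂ H H - z • ContinuousLinearMap.fst ℂ H H).comp B.graph.subtypeL
  have hφ : ∀ p : B.graph, φ p = (p : H × H).2 - z • (p : H × H).1 := fun p => rfl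
  have hrange : (shiftedRange B z : Set H) = Set.range φ := by
    ext y
    constructor
    · rintro ⟨x, rfl⟩
      exact ⟨⟨(x, B x), B.mem_graph x⟩, rfl⟩
    · rintro ⟨⟨p, hp⟩, rfl⟩
      obtain ⟨x, h1, h2⟩ := B.mem_graph_iff.1 hp
      exact ⟨x, by simp [hφ, ← h1, ← h2]⟩
  have hbound : ∀ p : B.graph, ‖p‖ ≤ (1 + (1 + ‖z‖) / c) * ‖φ p‖ := by
    rintro ⟨p, hp⟩
    obtain ⟨x, h1, h2⟩ := B.mem_graph_iff.1 hp
    have hx : ‖p.1‖ ≤ ‖p.2 - z • p.1‖ / c := by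
      rw [le_div_iff₀' hc, ← h1, ← h2]
      exact h x
    have hy : ‖p.2‖ ≤ ‖p.2 - z • p.1‖ + ‖z‖ * ‖p.1‖ := by
      rw [← norm_smul]
      simpa using norm_add_le (p.2 - z • p.1) (z • p.1)
    have hzx := mul_le_mul_of_nonneg_left hx (norm_nonneg z)
    have hpos := norm_nonneg (p.2 - z • p.1)
    have hq : 0 ≤ ‖p.2 - z • p.1‖ / c := by positivity
    have hexp : (1 + (1 + ‖z‖) / c) * ‖p.2 - z • p.1‖ =
        ‖p.2 - z • p.1‖ + ‖p.2 - z • p.1‖ / c + ‖z‖ * (‖p.2 - z • p.1‖ / c) := by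
      field_simp
      ring
    have hzq := mul_nonneg (norm_nonneg z) hq
    change ‖p‖ ≤ _ * ‖p.2 - z • p.1‖
    rw [hexp, Prod.norm_def]
    exact max_le (by linarith) (by linarith)
  have hanti : AntilipschitzWith (Real.toNNReal (1 + (1 + ‖z‖) / c)) φ := by
    refine AddMonoidHomClass.antilipschitz_of_bound φ fun p => ?_
    rw [Real.coe_toNNReal _ (by positivity)]
    exact hbound p
  rw [hrange]
  exact hanti.isClosed_range φ.uniformContinuous

/-- The cross term vanishes because `⟨B x, x⟩` is real. This one identity yields regularity of
nonreal imaginary points and isometry of the Cayley transform. -/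
theorem norm_sub_I_mul_smul_sq {B : H →ₗ.[ℂ] H} (hB : B.IsFormalAdjoint B) (t : ℝ)
    (x : B.domain) :
    ‖B x - (Complex.I * t) • (x : H)‖ ^ 2 = ‖B x‖ ^ 2 + t ^ 2 * ‖(x : H)‖ ^ 2 := by
  have hre : (inner ℂ (B x) (x : H)).im = 0 := by
    have h := inner_conj_symm (𝕜 := ℂ) (B x) (x : H)
    rw [← hB x x] at h
    exact Complex.conj_eq_iff_im.1 h
  rw [@norm_sub_sq ℂ, inner_smul_right, norm_smul]
  simp [hre, mul_pow]

theorem isRegularTypePoint_I_mul {B : H →ₗ.[ℂ] H} (hB : B.IsFormalAdjoint B) {t : ℝ}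
    (ht : t ≠ 0) : IsRegularTypePoint B (Complex.I * t) := by
  refine ⟨|t|, abs_pos.2 ht, fun x => ?_⟩
  refine le_of_sq_le_sq ?_ (norm_nonneg _)
  rw [norm_sub_I_mul_smul_sq hB, mul_pow, sq_abs]
  nlinarith [sq_nonneg ‖B x‖]

theorem isRegularTypePoint_neg_I_mul {B : H →ₗ.[ℂ] H} (hB : B.IsFormalAdjoint B) {t : ℝ}
    (ht : t ≠ 0) : IsRegularTypePoint B (-(Complex.I * t)) := by
  simpa using isRegularTypePoint_I_mul hB (neg_ne_zero.2 ht)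

theorem isFormalAdjoint_of_le {B A : H →ₗ.[ℂ] H} (hA : A.IsFormalAdjoint A) (h : B ≤ A) :
    B.IsFormalAdjoint B := fun x y => by
  have hx : (x : H) ∈ A.domain := h.1 x.2
  have hy : (y : H) ∈ A.domain := h.1 y.2
  rw [h.2 (y := ⟨x, hx⟩) rfl, h.2 (y := ⟨y, hy⟩) rfl]
  exact hA ⟨x, hx⟩ ⟨y, hy⟩

theorem eq_zero_of_regular {B : H →ₗ.[ℂ] H} {z : ℂ} (hz : IsRegularTypePoint B z) {x : H}
    (hx : (x, z • x) ∈ B.graph) : x = 0 := by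
  obtain ⟨c, hc, h⟩ := hz
  obtain ⟨y, rfl, h2⟩ := B.mem_graph_iff.1 hx
  have := h y
  rw [h2] at this
  simp only [sub_self, norm_zero] at this
  have h0 : ‖(y : H)‖ ≤ 0 := by nlinarith
  simpa using h0

theorem closure_le_of_isClosed {S A : H →ₗ.[ℂ] H} (hA : A.IsClosed) (h : S ≤ A) :
    S.closure ≤ A := by
  refine LinearPMap.le_of_le_graph ?_
  rw [← (hA.isClosable.leIsClosable h).graph_closure_eq_closure_graph]
  exact Submodule.topologicalClosure_minimal _ (LinearPMap.le_graph_of_le h) hA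

variable [CompleteSpace H]

theorem mem_adjoint_graph_iff {S : H →ₗ.[ℂ] H} (hS : Dense (S.domain : Set H)) {x y : H} :
    (x, y) ∈ S†.graph ↔ ∀ f : S.domain, inner ℂ (S f) x = inner ℂ (f : H) y := by
  rw [LinearPMap.adjoint_graph_eq_graph_adjoint hS, Submodule.mem_adjoint_iff]
  simp only [sub_eq_zero]
  constructor
  · exact fun h f => h _ _ (S.mem_graph f)
  · intro h a b hab
    obtain ⟨f, rfl, rfl⟩ := S.mem_graph_iff.1 hab
    exact h f

theorem _root_.IsSelfAdjoint.isFormalAdjoint_self {A : H →ₗ.[ℂ] H} (hA : IsSelfAdjoint A) :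
    A.IsFormalAdjoint A := by
  have h := LinearPMap.adjoint_isFormalAdjoint hA.dense_domain
  rwa [LinearPMap.isSelfAdjoint_def.1 hA] at h

theorem _root_.IsSelfAdjoint.mem_graph_iff_inner {A : H →ₗ.[ℂ] H} (hA : IsSelfAdjoint A)
    {x y : H} : (x, y) ∈ A.graph ↔ ∀ f : A.domain, inner ℂ (A f) x = inner ℂ (f : H) y := by
  rw [← mem_adjoint_graph_iff hA.dense_domain, LinearPMap.isSelfAdjoint_def.1 hA]

theorem le_adjoint_of_le {S A : H →ₗ.[ℂ] H} (hS : Dense (S.domain : Set H))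
    (hA : A.IsFormalAdjoint A) (h : S ≤ A) : A ≤ S† := by
  refine LinearPMap.IsFormalAdjoint.le_adjoint hS fun x y => ?_
  have hx : (x : H) ∈ A.domain := h.1 x.2
  rw [h.2 (y := ⟨x, hx⟩) rfl]
  exact hA ⟨x, hx⟩ y

theorem mem_deficiencySpace {S : H →ₗ.[ℂ] H} {z : ℂ} {x : H} :
    x ∈ deficiencySpace S z ↔ (x, z • x) ∈ S†.graph :=
  Iff.rfl

/-- For a fixed pair in the graph of `S†`, the identity cuts out a closed set of pairs, so it passes
from `S` to its closure. -/
theorem inner_closure_left {S : H →ₗ.[ℂ] H} (hS : Dense (S.domain : Set H))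
    (hcl : S.IsClosable) {x y : H} (hxy : (x, y) ∈ S†.graph) (f : S.closure.domain) :
    inner ℂ (S.closure f) x = inner ℂ (f : H) y := by
  have hclosed : IsClosed {p : H × H | inner ℂ p.2 x = inner ℂ p.1 y} :=
    isClosed_eq (by fun_prop) (by fun_prop)
  have hsub : (S.graph : Set (H × H)) ⊆ {p : H × H | inner ℂ p.2 x = inner ℂ p.1 y} := by
    intro p hp
    obtain ⟨a, h1, h2⟩ := S.mem_graph_iff.1 hp
    have := (mem_adjoint_graph_iff hS).1 hxy a
    simpa [h1, h2] using this
  have hmem : ((f : H), S.closure f) ∈ S.graph.topologicalClosure := by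
    rw [hcl.graph_closure_eq_closure_graph]
    exact S.closure.mem_graph f
  exact closure_minimal hsub hclosed hmem

theorem shiftedRange_orthogonal {S : H →ₗ.[ℂ] H} (hS : Dense (S.domain : Set H)) (z : ℂ) :
    (shiftedRange S z)ᗮ = deficiencySpace S (starRingEnd ℂ z) := by
  ext y
  rw [mem_deficiencySpace, mem_adjoint_graph_iff hS, Submodule.mem_orthogonal]
  constructor
  · intro h f
    have := h _ (sub_smul_mem_shiftedRange S z f)
    rw [inner_sub_left, inner_smul_left, sub_eq_zero] at this
    rw [this, inner_smul_right]
  · rintro h _ ⟨f, rfl⟩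
    have := h f
    rw [inner_smul_right] at this
    change inner ℂ (S f - z • (f : H)) y = 0
    rw [inner_sub_left, inner_smul_left, this, sub_self]

theorem shiftedRange_closure_orthogonal {S : H →ₗ.[ℂ] H} (hS : Dense (S.domain : Set H))
    (hcl : S.IsClosable) (z : ℂ) :
    (shiftedRange S.closure z)ᗮ = deficiencySpace S (starRingEnd ℂ z) := by
  apply le_antisymm
  · rw [← shiftedRange_orthogonal hS]
    apply Submodule.orthogonal_le
    rintro _ ⟨f, rfl⟩
    have hle := S.le_closure
    refine ⟨⟨f, hle.1 f.2⟩, ?_⟩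
    change S.closure ⟨f, _⟩ - z • (f : H) = S f - z • (f : H)
    rw [← hle.2 (x := f) (y := ⟨f, hle.1 f.2⟩) rfl]
  · rintro y hy _ ⟨f, rfl⟩
    have := inner_closure_left hS hcl (mem_deficiencySpace.1 hy) f
    rw [inner_smul_right] at this
    change inner ℂ (S.closure f - z • (f : H)) y = 0
    rw [inner_sub_left, inner_smul_left, this, sub_self]

theorem deficiencySpace_orthogonal {S : H →ₗ.[ℂ] H} (hS : Dense (S.domain : Set H))
    (hcl : S.IsClosable) {z : ℂ} (hz : IsRegularTypePoint S.closure (starRingEnd ℂ z)) :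
    (deficiencySpace S z)ᗮ = shiftedRange S.closure (starRingEnd ℂ z) := by
  have hclosed := isClosed_shiftedRange hcl.closure_isClosed hz
  have : CompleteSpace (shiftedRange S.closure (starRingEnd ℂ z)) := hclosed.completeSpace_coe
  have h := shiftedRange_closure_orthogonal hS hcl (starRingEnd ℂ z)
  rw [Complex.conj_conj] at h
  rw [← h, Submodule.orthogonal_orthogonal]

/-- The range is closed, and its orthogonal complement is the eigenspace of `A` at `-it`, which is
trivial by regularity. -/
theorem shiftedRange_eq_top {A : H →ₗ.[ℂ] H} (hA : IsSelfAdjoint A) {t : ℝ} (ht : t ≠ 0) :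
    shiftedRange A (Complex.I * t) = ⊤ := by
  have hclosed := isClosed_shiftedRange hA.isClosed
    (isRegularTypePoint_I_mul hA.isFormalAdjoint_self ht)
  have : CompleteSpace (shiftedRange A (Complex.I * t)) := hclosed.completeSpace_coe
  rw [← Submodule.orthogonal_eq_bot_iff, shiftedRange_orthogonal hA.dense_domain, eq_bot_iff]
  intro x hx
  rw [mem_deficiencySpace, LinearPMap.isSelfAdjoint_def.1 hA] at hx
  have hreg := isRegularTypePoint_I_mul hA.isFormalAdjoint_self (neg_ne_zero.2 ht)
  refine eq_zero_of_regular hreg ?_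
  simpa using hx

theorem deficiencyProj_eq {S : H →ₗ.[ℂ] H} (hS : Dense (S.domain : Set H)) {z : ℂ} {x y : H}
    (hx : x ∈ deficiencySpace S z) (hy : y ∈ (deficiencySpace S z)ᗮ) :
    deficiencyProj hS z (y + x) = x := by
  have : CompleteSpace (deficiencySpace S z) := (isClosed_deficiencySpace hS z).completeSpace_coe
  exact Submodule.eq_starProjection_of_mem_orthogonal' hx hy (add_comm y x)

end Basic

/-! ### The Cayley transform and the von Neumann parameter -/

section VonNeumann

variable {H : Type*} [NormedAddCommGroup H] [InnerProductSpace ℂ H] [CompleteSpace H]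

/-- The bijection `A - it` of the domain of a self-adjoint operator `A` onto the whole space. -/
def shiftEquiv {A : H →ₗ.[ℂ] H} (hA : IsSelfAdjoint A) {t : ℝ} (ht : t ≠ 0) :
    A.domain ≃ₗ[ℂ] H :=
  LinearEquiv.ofBijective (A.toFun - (Complex.I * (t : ℂ)) • A.domain.subtype) <| by
    constructor
    · rw [← LinearMap.ker_eq_bot, eq_bot_iff]
      intro x hx
      have hx' : A x - (Complex.I * t) • (x : H) = 0 := hx
      have hreg := isRegularTypePoint_I_mul hA.isFormalAdjoint_self ht
      have h0 := eq_zero_of_regular hreg (x := (x : H))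
        (by rw [← sub_eq_zero.1 hx']; exact A.mem_graph x)
      exact Subtype.ext h0
    · exact LinearMap.range_eq_top.1 (shiftedRange_eq_top hA ht)

theorem shiftEquiv_apply {A : H →ₗ.[ℂ] H} (hA : IsSelfAdjoint A) {t : ℝ} (ht : t ≠ 0)
    (x : A.domain) : shiftEquiv hA ht x = A x - (Complex.I * t) • (x : H) :=
  rfl

/-- The Cayley transform `(A - it) (A + it)⁻¹` of a self-adjoint operator. -/
def cayley {A : H →ₗ.[ℂ] H} (hA : IsSelfAdjoint A) {t : ℝ} (ht : t ≠ 0) : H ≃ₗᵢ[ℂ] H where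
  toLinearEquiv := (shiftEquiv hA (neg_ne_zero.2 ht)).symm.trans (shiftEquiv hA ht)
  norm_map' y := by
    obtain ⟨x, rfl⟩ := (shiftEquiv hA (neg_ne_zero.2 ht)).surjective y
    rw [LinearEquiv.trans_apply, LinearEquiv.symm_apply_apply, shiftEquiv_apply, shiftEquiv_apply,
      ← sq_eq_sq₀ (norm_nonneg _) (norm_nonneg _),
      norm_sub_I_mul_smul_sq hA.isFormalAdjoint_self,
      norm_sub_I_mul_smul_sq hA.isFormalAdjoint_self, neg_sq]

theorem cayley_apply {A : H →ₗ.[ℂ] H} (hA : IsSelfAdjoint A) {t : ℝ} (ht : t ≠ 0)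
    (x : A.domain) : cayley hA ht (A x + (Complex.I * t) • (x : H)) =
      A x - (Complex.I * t) • (x : H) := by
  have h : A x + (Complex.I * t) • (x : H) = shiftEquiv hA (neg_ne_zero.2 ht) x := by
    rw [shiftEquiv_apply]
    push_cast
    module
  rw [h]
  exact (congrArg (shiftEquiv hA ht) (LinearEquiv.symm_apply_apply _ _)).trans
    (shiftEquiv_apply hA ht x)

theorem cayley_apply_of_mem_graph {A : H →ₗ.[ℂ] H} (hA : IsSelfAdjoint A) {t : ℝ} (ht : t ≠ 0)
    {x y : H} (h : (x, y) ∈ A.graph) : cayley hA ht (y + (Complex.I * t) • x) =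
      y - (Complex.I * t) • x := by
  obtain ⟨a, rfl, rfl⟩ := A.mem_graph_iff.1 h
  exact cayley_apply hA ht a

theorem exists_mem_graph_add_smul_eq {A : H →ₗ.[ℂ] H} (hA : IsSelfAdjoint A) {t : ℝ}
    (ht : t ≠ 0) (h : H) : ∃ x y, (x, y) ∈ A.graph ∧ y + (Complex.I * t) • x = h := by
  obtain ⟨x, rfl⟩ := (shiftEquiv hA (neg_ne_zero.2 ht)).surjective h
  refine ⟨x, A x, A.mem_graph x, ?_⟩
  rw [shiftEquiv_apply]
  push_cast
  module

theorem conj_I_mul (t : ℝ) : starRingEnd ℂ (Complex.I * t) = -(Complex.I * t) := by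
  simp

/-- A unitary respects orthogonal complements, so it suffices that it maps `ran (S̄ + it)` onto `ran
(S̄ - it)`. -/
theorem map_cayley_deficiencySpace {S A : H →ₗ.[ℂ] H} (hS : Dense (S.domain : Set H))
    (hA : IsSelfAdjoint A) (h : S ≤ A) {t : ℝ} (ht : t ≠ 0) :
    (deficiencySpace S (Complex.I * t)).map
        ((cayley hA ht).toLinearEquiv : H →ₗ[ℂ] H) =
      deficiencySpace S (-(Complex.I * t)) := by
  have hcl : S.IsClosable := hA.isClosed.isClosable.leIsClosable h
  have hle := closure_le_of_isClosed hA.isClosed h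
  have hV : ∀ f : S.closure.domain, cayley hA ht (S.closure f - (-(Complex.I * t)) • (f : H)) =
      S.closure f - (Complex.I * t) • (f : H) := fun f => by
    rw [neg_smul, sub_neg_eq_add, cayley_apply_of_mem_graph hA ht (mem_graph_of_le hle f)]
  have h1 := shiftedRange_closure_orthogonal hS hcl (-(Complex.I * t))
  have h2 := shiftedRange_closure_orthogonal hS hcl (Complex.I * t)
  rw [map_neg, conj_I_mul, neg_neg] at h1
  rw [conj_I_mul] at h2
  rw [← h1, ← h2, Submodule.map_orthogonal_equiv]
  congr 1
  ext y
  constructor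
  · rintro ⟨_, ⟨f, rfl⟩, rfl⟩
    exact ⟨f, (hV f).symm⟩
  · rintro ⟨f, rfl⟩
    exact ⟨_, ⟨f, rfl⟩, hV f⟩

theorem exists_isVonNeumannParameter {S A : H →ₗ.[ℂ] H} (hS : Dense (S.domain : Set H))
    (hA : IsSelfAdjoint A) (h : S ≤ A) {ε : ℝ} (hε : ε ≠ 0) :
    ∃ U, IsVonNeumannParameter S A ε U := by
  have hcl : S.IsClosable := hA.isClosed.isClosable.leIsClosable h
  have hle := closure_le_of_isClosed hA.isClosed h
  have hsymm := isFormalAdjoint_of_le hA.isFormalAdjoint_self hle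
  let U : deficiencySpace S (Complex.I * ε) ≃ₗᵢ[ℂ] deficiencySpace S (-(Complex.I * ε)) :=
    ((cayley hA hε).submoduleMap (deficiencySpace S (Complex.I * ε))).trans
      (LinearIsometryEquiv.ofEq _ _ (map_cayley_deficiencySpace hS hA h hε))
  have hU : ∀ u, (U u : H) = cayley hA hε u := fun u => rfl
  have hz : Complex.I * (ε : ℂ) ≠ 0 := by simp [hε]
  have h2z : 2 * (Complex.I * (ε : ℂ)) ≠ 0 := mul_ne_zero two_ne_zero hz
  have hreg : IsRegularTypePoint S.closure (starRingEnd ℂ (Complex.I * ε)) := by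
    rw [conj_I_mul]
    exact isRegularTypePoint_neg_I_mul hsymm hε
  have horth := deficiencySpace_orthogonal hS hcl hreg
  rw [conj_I_mul] at horth
  refine ⟨U, Set.Subset.antisymm ?_ ?_⟩
  · rintro ⟨x, y⟩ hxy
    have hV := cayley_apply_of_mem_graph hA hε hxy
    have hcomp : CompleteSpace (deficiencySpace S (Complex.I * ε)) :=
      (isClosed_deficiencySpace hS _).completeSpace_coe
    -- Split `(A + iε) x` along `ker (S* - iε) ⊕ ran (S̄ + iε)`.
    obtain ⟨p, hp, q, hq, hpq⟩ := Submodule.exists_add_mem_mem_orthogonal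
      (K := deficiencySpace S (Complex.I * ε)) (y + (Complex.I * ε) • x)
    rw [horth] at hq
    obtain ⟨f, hf⟩ := mem_shiftedRange.1 hq
    -- The factor is forced by `(A + iε)(u - U u) = 2iε u`.
    let u : deficiencySpace S (Complex.I * ε) :=
      ⟨(2 * (Complex.I * (ε : ℂ)))⁻¹ • p, Submodule.smul_mem _ _ hp⟩
    have hu : p = (2 * (Complex.I * (ε : ℂ))) • (u : H) := by
      simp only [u]
      rw [smul_inv_smul₀ h2z]
    have hq' : q = S.closure f + (Complex.I * ε) • (f : H) := by
      rw [← hf]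
      module
    have hVq : cayley hA hε q = S.closure f - (Complex.I * ε) • (f : H) := by
      rw [hq', cayley_apply_of_mem_graph hA hε (mem_graph_of_le hle f)]
    rw [hpq, map_add, hVq, hu, map_smul, ← hU] at hV
    rw [hu, hq'] at hpq
    refine ⟨f, u, ?_, ?_⟩
    -- The sum and difference of the formulas for `(A + iε) x` and `(A - iε) x` recover `2iε x` and
    -- `2 y`.
    · apply smul_right_injective H h2z
      dsimp only
      linear_combination (norm := module) hpq + hV
    · apply smul_right_injective H (two_ne_zero (α := ℂ))
      dsimp only
      linear_combination (norm := module) hpq - hV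
  · rintro ⟨x, y⟩ ⟨f, u, hx, hy⟩
    -- Solve `(A + iε) a = 2iε u`; applying the Cayley transform identifies `a` and `b = A a`.
    obtain ⟨a, b, hab, hu⟩ := exists_mem_graph_add_smul_eq hA hε
      ((2 * (Complex.I * (ε : ℂ))) • (u : H))
    have hV := cayley_apply_of_mem_graph hA hε hab
    rw [hu, map_smul, ← hU] at hV
    have ha : a = u - U u := by
      apply smul_right_injective H h2z
      dsimp only
      linear_combination (norm := module) hu + hV
    have hb : b = (Complex.I * ε) • (u : H) + (Complex.I * ε) • (U u : H) := by
      apply smul_right_injective H (two_ne_zero (α := ℂ))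
      dsimp only
      linear_combination (norm := module) hu - hV
    have hsum := A.graph.add_mem (mem_graph_of_le hle f) hab
    rw [ha, hb] at hsum
    simp only at hx hy
    rw [hx, hy, add_sub_assoc, add_assoc]
    exact hsum

/-- Subtracting the two graph elements built from the same `u` makes `U' u - U u` an eigenvector of
`A` at `-iε`, hence zero. -/
theorem isVonNeumannParameter_unique {S A : H →ₗ.[ℂ] H} (hA : IsSelfAdjoint A) {ε : ℝ}
    (hε : ε ≠ 0)
    {U U' : deficiencySpace S (Complex.I * ε) ≃ₗᵢ[ℂ] deficiencySpace S (-(Complex.I * ε))}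
    (hU : IsVonNeumannParameter S A ε U) (hU' : IsVonNeumannParameter S A ε U') : U = U' := by
  have hmem : ∀ V, IsVonNeumannParameter S A ε V → ∀ u : deficiencySpace S (Complex.I * ε),
      ((u : H) - V u, (Complex.I * ε) • (u : H) + (Complex.I * ε) • (V u : H)) ∈ A.graph := by
    intro V hV u
    have : ((u : H) - V u, (Complex.I * ε) • (u : H) + (Complex.I * ε) • (V u : H)) ∈
        vonNeumannGraph S ε V := ⟨0, u, by simp, by simp [LinearPMap.map_zero]⟩
    rwa [← hV] at this
  ext u
  have hsub := A.graph.sub_mem (hmem U hU u) (hmem U' hU' u)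
  have hzero := eq_zero_of_regular (x := (U' u : H) - U u)
    (isRegularTypePoint_neg_I_mul hA.isFormalAdjoint_self hε) (by
      convert hsub using 1
      ext
      · simp
      · simp only [Prod.snd_sub]
        module)
  exact (sub_eq_zero.1 hzero).symm

end VonNeumann

/-! ### Operator parts of self-adjoint linear relations -/

section OperatorPart

variable {H : Type*} [NormedAddCommGroup H] [InnerProductSpace ℂ H]

/-- The last conjunct comes from density of the domain in the hidden subspace `K`; it separates `T
u` from the multivalued part. -/
theorem IsSelfAdjointInSubspace.mem {N : Submodule ℂ H} {T : H →ₗ.[ℂ] H}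
    (hT : IsSelfAdjointInSubspace N T) (u : T.domain) :
    (u : H) ∈ N ∧ T u ∈ N ∧ T u ∈ T.domain.topologicalClosure := by
  obtain ⟨K, hK, B, hKN, hB, hgraph⟩ := hT
  have hu := T.mem_graph u
  rw [hgraph] at hu
  obtain ⟨⟨x, y⟩, hxy, heq⟩ := hu
  simp only [LinearMap.prodMap_apply, Submodule.subtype_apply, Prod.mk.injEq] at heq
  rw [← heq.1, ← heq.2]
  refine ⟨hKN x.2, hKN y.2, ?_⟩
  have hmaps : Set.MapsTo (Subtype.val : K → H) (B.domain : Set K) (T.domain : Set H) := by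
    intro a ha
    refine LinearPMap.mem_domain_iff.2 ⟨B ⟨a, ha⟩, ?_⟩
    rw [hgraph]
    exact ⟨(a, B ⟨a, ha⟩), B.mem_graph ⟨a, ha⟩, rfl⟩
  exact map_mem_closure continuous_subtype_val (hB.dense_domain y) hmaps

/-- A linear relation determines its operator part. -/
theorem eq_of_operatorPart {L : Set (H × H)} {N : Submodule ℂ H} {T T' : H →ₗ.[ℂ] H}
    (hT : IsSelfAdjointInSubspace N T) (hT' : IsSelfAdjointInSubspace N T')
    (hL : ∀ v n, (v, n) ∈ L ↔ ∃ (u : T.domain), ∃ w ∈ N ⊓ T.domainᗮ, v = u ∧ n = T u + w)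
    (hL' : ∀ v n, (v, n) ∈ L ↔ ∃ (u : T'.domain), ∃ w ∈ N ⊓ T'.domainᗮ, v = u ∧ n = T' u + w) :
    T = T' := by
  have hdom : T.domain = T'.domain := by
    ext v
    constructor
    · intro hv
      obtain ⟨u, -, -, rfl, -⟩ := (hL' v (T ⟨v, hv⟩)).1
        ((hL _ _).2 ⟨⟨v, hv⟩, 0, Submodule.zero_mem _, rfl, by simp⟩)
      exact u.2
    · intro hv
      obtain ⟨u, -, -, rfl, -⟩ := (hL v (T' ⟨v, hv⟩)).1
        ((hL' _ _).2 ⟨⟨v, hv⟩, 0, Submodule.zero_mem _, rfl, by simp⟩)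
      exact u.2
  refine LinearPMap.ext hdom fun x hx hx' => ?_
  obtain ⟨u, w, hw, hu, hTu⟩ := (hL' x (T ⟨x, hx⟩)).1
    ((hL _ _).2 ⟨⟨x, hx⟩, 0, Submodule.zero_mem _, rfl, by simp⟩)
  obtain rfl : u = ⟨x, hx'⟩ := Subtype.ext hu.symm
  -- The discrepancy `w` is a difference of values in the common closure of the domains, yet
  -- orthogonal to it.
  have hclos : w ∈ T'.domain.topologicalClosure := by
    have heq : T.domain.topologicalClosure = T'.domain.topologicalClosure := by rw [hdom]
    have := Submodule.sub_mem _ (heq.le (hT.mem ⟨x, hx⟩).2.2) (hT'.mem ⟨x, hx'⟩).2.2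
    rwa [hTu, add_sub_cancel_left] at this
  have hworth : w ∈ T'.domain.topologicalClosureᗮ := by
    rw [Submodule.orthogonal_closure]
    exact hw.2
  have hw0 : w = 0 := by
    have : w ∈ T'.domain.topologicalClosure ⊓ T'.domain.topologicalClosureᗮ := ⟨hclos, hworth⟩
    rwa [Submodule.inf_orthogonal_eq_bot] at this
  rw [hTu, hw0, add_zero]

variable [CompleteSpace H]

/-- A self-adjoint linear relation `L` in a closed subspace `N` is the orthogonal sum of a
self-adjoint operator in a closed subspace of `N` and its multivalued part. -/
theorem exists_operatorPart {N : Submodule ℂ H} (hN : IsClosed (N : Set H))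
    {L : Submodule ℂ (H × H)}
    (hL : ∀ v n, (v, n) ∈ L ↔
      v ∈ N ∧ n ∈ N ∧ ∀ v' n', (v', n') ∈ L → inner ℂ n' v = inner ℂ v' n) :
    ∃ T : H →ₗ.[ℂ] H, IsSelfAdjointInSubspace N T ∧
      ∀ v n, (v, n) ∈ L ↔ ∃ (u : T.domain), ∃ w ∈ N ⊓ T.domainᗮ, v = u ∧ n = T u + w := by
  let D : Submodule ℂ H := L.map (LinearMap.fst ℂ H H)
  have hD : ∀ {v n}, (v, n) ∈ L → v ∈ D := fun {v n} h => ⟨(v, n), h, rfl⟩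
  let K : Submodule ℂ H := D.topologicalClosure
  have hDK : D ≤ K := D.le_topologicalClosure
  have hKc : CompleteSpace K := D.isClosed_topologicalClosure.completeSpace_coe
  have hKN : K ≤ N := by
    refine D.topologicalClosure_minimal ?_ hN
    rintro _ ⟨⟨v, n⟩, h, rfl⟩
    exact ((hL v n).1 h).1
  have hKorth : Kᗮ = Dᗮ := D.orthogonal_closure
  -- Putting `v = 0` in the self-adjointness criterion identifies the multivalued part of `L` as `N
  -- ⊓ Dᗮ`.
  have hmul : ∀ w ∈ N ⊓ Dᗮ, ((0 : H), w) ∈ L := by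
    intro w hw
    refine (hL 0 w).2 ⟨N.zero_mem, hw.1, fun v' n' h => ?_⟩
    rw [inner_zero_right, Submodule.inner_right_of_mem_orthogonal (hD h) hw.2]
  have hmul' : ∀ w, ((0 : H), w) ∈ L → w ∈ Dᗮ := by
    rintro w hw _ ⟨⟨v', n'⟩, h, rfl⟩
    have := ((hL 0 w).1 hw).2.2 v' n' h
    rw [inner_zero_right] at this
    exact this.symm
  have hsplit : ∀ v n, (v, n) ∈ L → ∃ m ∈ K, ∃ w ∈ N ⊓ Dᗮ, n = m + w ∧ (v, m) ∈ L := by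
    intro v n h
    obtain ⟨m, hm, w, hw, hmw⟩ := Submodule.exists_add_mem_mem_orthogonal (K := K) n
    rw [hKorth] at hw
    have hwN : w ∈ N := by
      rw [← add_sub_cancel_left m w, ← hmw]
      exact N.sub_mem ((hL v n).1 h).2.1 (hKN hm)
    refine ⟨m, hm, w, ⟨hwN, hw⟩, hmw, ?_⟩
    have := L.sub_mem h (hmul w ⟨hwN, hw⟩)
    simpa [hmw] using this
  have hsingle : ∀ m ∈ K, ((0 : H), m) ∈ L → m = 0 := by
    intro m hm h
    have h1 := hmul' m h
    rw [← hKorth] at h1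
    have : m ∈ K ⊓ Kᗮ := ⟨hm, h1⟩
    rwa [K.inf_orthogonal_eq_bot] at this
  -- `B` and `T` are the same cut of `L` down to `K × K`, viewed inside `K` and inside `H`;
  -- `hsingle` makes it single-valued.
  let B : K →ₗ.[ℂ] K := (L.comap (K.subtype.prodMap K.subtype)).toLinearPMap
  have hB : B.graph = L.comap (K.subtype.prodMap K.subtype) := by
    refine Submodule.toLinearPMap_graph_eq _ ?_
    rintro ⟨x, y⟩ hx hx0
    simp only at hx0
    subst hx0
    exact Subtype.ext (hsingle y y.2 (by simpa using hx))
  have hBmem : ∀ x y : K, (x, y) ∈ B.graph ↔ ((x : H), (y : H)) ∈ L := fun x y => by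
    rw [hB]; rfl
  let T : H →ₗ.[ℂ] H := (L ⊓ K.prod K).toLinearPMap
  have hT : T.graph = L ⊓ K.prod K := by
    refine Submodule.toLinearPMap_graph_eq _ ?_
    rintro ⟨x, y⟩ ⟨hx, hxK⟩ hx0
    simp only at hx0
    subst hx0
    exact hsingle y hxK.2 hx
  have hTdom : T.domain = D := by
    ext v
    rw [LinearPMap.mem_domain_iff]
    constructor
    · rintro ⟨y, hy⟩
      rw [hT] at hy
      exact hD hy.1
    · rintro ⟨⟨v, n⟩, h, rfl⟩
      obtain ⟨m, hm, -, -, -, hvm⟩ := hsplit v n h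
      exact ⟨m, by rw [hT]; exact ⟨hvm, hDK (hD h), hm⟩⟩
  have hBdense : Dense (B.domain : Set K) := by
    rw [Submodule.dense_iff_topologicalClosure_eq_top, Submodule.topologicalClosure_eq_top_iff,
      eq_bot_iff]
    intro x hx
    have hxD : (x : H) ∈ Dᗮ := by
      rintro _ ⟨⟨v, n⟩, h, rfl⟩
      obtain ⟨m, hm, -, -, -, hvm⟩ := hsplit v n h
      have hv : (⟨v, hDK (hD h)⟩ : K) ∈ B.domain :=
        LinearPMap.mem_domain_iff.2 ⟨⟨m, hm⟩, (hBmem _ _).2 hvm⟩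
      exact hx _ hv
    rw [← hKorth] at hxD
    have : (x : H) ∈ K ⊓ Kᗮ := ⟨x.2, hxD⟩
    rw [K.inf_orthogonal_eq_bot] at this
    exact Subtype.ext this
  refine ⟨T, ⟨K, hKc, B, hKN, ?_, ?_⟩, ?_⟩
  · rw [LinearPMap.isSelfAdjoint_def]
    apply LinearPMap.eq_of_eq_graph
    rw [LinearPMap.adjoint_graph_eq_graph_adjoint hBdense]
    ext ⟨x, y⟩
    rw [Submodule.mem_adjoint_iff, hBmem, hL]
    simp only [sub_eq_zero]
    constructor
    · intro h
      refine ⟨hKN x.2, hKN y.2, fun v' n' h' => ?_⟩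
      -- Testing against `B` alone suffices: the multivalued component of `n'` is orthogonal to `x ∈
      -- K`.
      obtain ⟨m, hm, w, hw, rfl, hvm⟩ := hsplit v' n' h'
      have hw' : w ∈ Kᗮ := by rw [hKorth]; exact hw.2
      rw [inner_add_left, Submodule.inner_left_of_mem_orthogonal x.2 hw', add_zero]
      exact h ⟨v', hDK (hD h')⟩ ⟨m, hm⟩ ((hBmem _ _).2 hvm)
    · intro h a b hab
      exact h.2.2 a b ((hBmem _ _).1 hab)
  · rw [hT, hB, Submodule.map_comap_eq]
    ext ⟨x, y⟩
    simp only [Submodule.mem_inf, Submodule.mem_prod, LinearMap.mem_range, Prod.exists,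
      LinearMap.prodMap_apply, Submodule.subtype_apply, Prod.mk.injEq, Subtype.exists]
    constructor
    · rintro ⟨h, hx, hy⟩
      exact ⟨⟨x, hx, y, hy, rfl, rfl⟩, h⟩
    · rintro ⟨⟨_, hx, _, hy, rfl, rfl⟩, h⟩
      exact ⟨h, hx, hy⟩
  · intro v n
    have hTorth : T.domainᗮ = Dᗮ := by rw [hTdom]
    rw [hTorth]
    constructor
    · intro h
      obtain ⟨m, hm, w, hw, rfl, hvm⟩ := hsplit v n h
      have hmem : (v, m) ∈ T.graph := by rw [hT]; exact ⟨hvm, hDK (hD h), hm⟩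
      obtain ⟨u, rfl, rfl⟩ := T.mem_graph_iff.1 hmem
      exact ⟨u, w, hw, rfl, rfl⟩
    · rintro ⟨u, w, hw, rfl, rfl⟩
      have hmem := T.mem_graph u
      rw [hT] at hmem
      have := L.add_mem hmem.1 (hmul w hw)
      simpa using this

end OperatorPart

/-! ### The relative parameter, component formulas and the key estimate -/

section RelativeParameter

variable {H : Type*} [NormedAddCommGroup H] [InnerProductSpace ℂ H]

theorem IsBoundedInverse.mem_graph {B : H →ₗ.[ℂ] H} {R : H →L[ℂ] H} (hR : IsBoundedInverse B R)
    (y : H) : (R y, y) ∈ B.graph := by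
  obtain ⟨h, hy⟩ := hR.2 y
  exact B.mem_graph_iff.2 ⟨⟨R y, h⟩, rfl, hy⟩

theorem IsBoundedInverse.apply_of_mem_graph {B : H →ₗ.[ℂ] H} {R : H →L[ℂ] H}
    (hR : IsBoundedInverse B R) {x y : H} (h : (x, y) ∈ B.graph) : R y = x := by
  obtain ⟨a, rfl, rfl⟩ := B.mem_graph_iff.1 h
  exact hR.1 a

theorem IsBoundedInverse.inner_apply_left {B : H →ₗ.[ℂ] H} {R : H →L[ℂ] H}
    (hR : IsBoundedInverse B R) (hB : B.IsFormalAdjoint B) (x y : H) :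
    inner ℂ (R x) y = inner ℂ x (R y) := by
  obtain ⟨hx, hx'⟩ := hR.2 x
  obtain ⟨hy, hy'⟩ := hR.2 y
  have := hB ⟨R x, hx⟩ ⟨R y, hy⟩
  rw [hx', hy'] at this
  exact this.symm

variable [CompleteSpace H]

theorem mem_deficiencySpace_zero {S : H →ₗ.[ℂ] H} {x : H} :
    x ∈ deficiencySpace S 0 ↔ (x, 0) ∈ S†.graph := by
  rw [mem_deficiencySpace, zero_smul]

theorem closure_apply_mem_orthogonal {S : H →ₗ.[ℂ] H} (hS : Dense (S.domain : Set H))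
    (hcl : S.IsClosable) (f : S.closure.domain) :
    S.closure f ∈ (deficiencySpace S 0)ᗮ := by
  refine (Submodule.mem_orthogonal' _ _).2 fun n hn => ?_
  rw [inner_closure_left hS hcl (mem_deficiencySpace_zero.1 hn), inner_zero_right]

theorem closure_sub_smul_mem_orthogonal {S : H →ₗ.[ℂ] H} (hS : Dense (S.domain : Set H))
    (hcl : S.IsClosable) (z : ℂ) (f : S.closure.domain) :
    S.closure f - (starRingEnd ℂ z) • (f : H) ∈ (deficiencySpace S z)ᗮ := by
  have h := shiftedRange_closure_orthogonal hS hcl (starRingEnd ℂ z)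
  rw [Complex.conj_conj] at h
  rw [← h]
  exact Submodule.le_orthogonal_orthogonal _ (sub_smul_mem_shiftedRange _ _ f)

/-- The linear relation in `ker S*` associated with the extension `A` of `S`, relative to the
distinguished extension with inverse `R`. -/
def boundaryRelation (S A : H →ₗ.[ℂ] H) (R : H →L[ℂ] H) : Submodule ℂ (H × H) :=
  (deficiencySpace S 0).prod (deficiencySpace S 0) ⊓
    A.graph.comap (((R : H →ₗ[ℂ] H) ∘ₗ LinearMap.snd ℂ H H + LinearMap.fst ℂ H H).prod
      (LinearMap.snd ℂ H H))

theorem mem_boundaryRelation {S A : H →ₗ.[ℂ] H} {R : H →L[ℂ] H} {v n : H} :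
    (v, n) ∈ boundaryRelation S A R ↔
      (v ∈ deficiencySpace S 0 ∧ n ∈ deficiencySpace S 0) ∧ (R n + v, n) ∈ A.graph :=
  Iff.rfl

section

variable {S SD A : H →ₗ.[ℂ] H} {R : H →L[ℂ] H}

theorem exists_boundaryRelation_decomposition (hS : Dense (S.domain : Set H))
    (hreg : IsRegularTypePoint S.closure 0) (hSD : IsSelfAdjoint SD) (hSSD : S ≤ SD)
    (hR : IsBoundedInverse SD R) (hA : IsSelfAdjoint A) (hSA : S ≤ A) {x y : H}
    (hxy : (x, y) ∈ A.graph) :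
    ∃ (f : S.closure.domain) (v n : H), (v, n) ∈ boundaryRelation S A R ∧
      x = f + R n + v ∧ y = S.closure f + n := by
  have hcl : S.IsClosable := hA.isClosed.isClosable.leIsClosable hSA
  have hcomp : CompleteSpace (deficiencySpace S 0) :=
    (isClosed_deficiencySpace hS _).completeSpace_coe
  obtain ⟨n, hn, q, hq, hy⟩ :=
    Submodule.exists_add_mem_mem_orthogonal (K := deficiencySpace S 0) y
  rw [deficiencySpace_orthogonal hS hcl (by simpa using hreg)] at hq
  obtain ⟨f, hf⟩ := mem_shiftedRange.1 hq
  rw [map_zero, zero_smul, sub_zero] at hf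
  subst hf
  have hRf : R (S.closure f) = f :=
    hR.apply_of_mem_graph (mem_graph_of_le (closure_le_of_isClosed hSD.isClosed hSSD) f)
  have hx : x = f + R n + (x - R y) := by
    rw [hy, map_add, hRf]
    abel
  refine ⟨f, x - R y, n, mem_boundaryRelation.2 ⟨⟨?_, hn⟩, ?_⟩, hx, by rw [hy, add_comm]⟩
  -- `S*` sends both `x` and `R y` to `y`.
  · have h1 := LinearPMap.le_graph_of_le (le_adjoint_of_le hS hA.isFormalAdjoint_self hSA) hxy
    have h2 := LinearPMap.le_graph_of_le (le_adjoint_of_le hS hSD.isFormalAdjoint_self hSSD)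
      (hR.mem_graph y)
    rw [mem_deficiencySpace_zero]
    simpa using Submodule.sub_mem _ h1 h2
  · have := A.graph.sub_mem hxy
      (mem_graph_of_le (closure_le_of_isClosed hA.isClosed hSA) f)
    convert this using 1
    ext
    · simp only [Prod.fst_sub]
      linear_combination (norm := module) -hx
    · simp [hy]

/-- Symmetry of `A` reduces to that of the relation since the `R` terms cancel. For maximality,
every test vector in the domain of `A` is decomposed; its `S̄ f` part pairs correctly because `S̄ f
⊥ v` and `R (S̄ f) = f`. -/
theorem boundaryRelation_selfAdjoint (hS : Dense (S.domain : Set H))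
    (hreg : IsRegularTypePoint S.closure 0) (hSD : IsSelfAdjoint SD) (hSSD : S ≤ SD)
    (hR : IsBoundedInverse SD R) (hA : IsSelfAdjoint A) (hSA : S ≤ A) (v n : H) :
    (v, n) ∈ boundaryRelation S A R ↔ v ∈ deficiencySpace S 0 ∧ n ∈ deficiencySpace S 0 ∧
      ∀ v' n', (v', n') ∈ boundaryRelation S A R → inner ℂ n' v = inner ℂ v' n := by
  have hcl : S.IsClosable := hA.isClosed.isClosable.leIsClosable hSA
  have hRsymm := hR.inner_apply_left hSD.isFormalAdjoint_self
  constructor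
  · intro h
    rw [mem_boundaryRelation] at h
    refine ⟨h.1.1, h.1.2, fun v' n' h' => ?_⟩
    obtain ⟨a, ha1, ha2⟩ := A.mem_graph_iff.1 (mem_boundaryRelation.1 h').2
    have := hA.mem_graph_iff_inner.1 h.2 a
    simp only at ha1 ha2
    rw [ha1, ha2, inner_add_left, inner_add_right, hRsymm] at this
    exact add_left_cancel this
  · rintro ⟨hv, hn, h⟩
    refine mem_boundaryRelation.2 ⟨⟨hv, hn⟩, hA.mem_graph_iff_inner.2 fun a => ?_⟩
    obtain ⟨f, v', n', h', ha, hAa⟩ :=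
      exists_boundaryRelation_decomposition hS hreg hSD hSSD hR hA hSA (A.mem_graph a)
    have hRf : R (S.closure f) = f :=
      hR.apply_of_mem_graph (mem_graph_of_le (closure_le_of_isClosed hSD.isClosed hSSD) f)
    have h0 := Submodule.inner_left_of_mem_orthogonal hv (closure_apply_mem_orthogonal hS hcl f)
    rw [ha, hAa]
    simp only [inner_add_left, inner_add_right]
    rw [h0, ← hRsymm, hRf, ← hRsymm n' n, h v' n' h']
    ring

theorem graph_eq_relativeGraph_iff (hS : Dense (S.domain : Set H))
    (hreg : IsRegularTypePoint S.closure 0) (hSD : IsSelfAdjoint SD) (hSSD : S ≤ SD)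
    (hR : IsBoundedInverse SD R) (hA : IsSelfAdjoint A) (hSA : S ≤ A) {T : H →ₗ.[ℂ] H}
    (hT : IsSelfAdjointInSubspace (deficiencySpace S 0) T) :
    (A.graph : Set (H × H)) = relativeGraph S R T ↔
      ∀ v n, (v, n) ∈ boundaryRelation S A R ↔
        ∃ (u : T.domain), ∃ w ∈ deficiencySpace S 0 ⊓ T.domainᗮ, v = u ∧ n = T u + w := by
  have hcl : S.IsClosable := hA.isClosed.isClosable.leIsClosable hSA
  constructor
  · intro h v n
    rw [mem_boundaryRelation]
    have hmem : ∀ p, p ∈ A.graph ↔ p ∈ relativeGraph S R T := fun p => by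
      rw [← h]; rfl
    rw [hmem]
    constructor
    · rintro ⟨⟨hv, hn⟩, f, u, w, h1, h2⟩
      simp only at h1 h2
      -- `S̄ f = n - (T u + w)` lies in both `ker S*` and its orthogonal complement.
      have hf0 : S.closure f = 0 := by
        have hmemN : S.closure f ∈ deficiencySpace S 0 := by
          have : S.closure f = n - (T u + w) := by rw [h2]; abel
          rw [this]
          exact Submodule.sub_mem _ hn (Submodule.add_mem _ (hT.mem u).2.1 w.2.1)
        have : S.closure f ∈ deficiencySpace S 0 ⊓ (deficiencySpace S 0)ᗮ :=
          ⟨hmemN, closure_apply_mem_orthogonal hS hcl f⟩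
        rwa [Submodule.inf_orthogonal_eq_bot] at this
      have hf : (f : H) = 0 := eq_zero_of_regular hreg (by
        rw [zero_smul, ← hf0]
        exact S.closure.mem_graph f)
      rw [hf0, zero_add] at h2
      rw [hf, zero_add, h2] at h1
      exact ⟨u, w, w.2, add_left_cancel h1, h2⟩
    · rintro ⟨u, w, hw, rfl, rfl⟩
      exact ⟨⟨(hT.mem u).1, Submodule.add_mem _ (hT.mem u).2.1 hw.1⟩, 0, u, ⟨w, hw⟩,
        by simp, by simp [LinearPMap.map_zero]⟩
  · intro h
    ext ⟨x, y⟩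
    constructor
    · intro hxy
      obtain ⟨f, v, n, hvn, rfl, rfl⟩ :=
        exists_boundaryRelation_decomposition hS hreg hSD hSSD hR hA hSA hxy
      obtain ⟨u, w, hw, rfl, rfl⟩ := (h v n).1 hvn
      exact ⟨f, u, ⟨w, hw⟩, rfl, (add_assoc _ _ _).symm⟩
    · rintro ⟨f, u, w, h1, h2⟩
      simp only at h1 h2
      have := A.graph.add_mem (mem_graph_of_le (closure_le_of_isClosed hA.isClosed hSA) f)
        (mem_boundaryRelation.1 ((h _ _).2 ⟨u, w, w.2, rfl, rfl⟩)).2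
      rw [h1, h2, add_assoc, add_assoc]
      exact this

theorem existsUnique_isRelativeParameter (hS : Dense (S.domain : Set H))
    (hreg : IsRegularTypePoint S.closure 0) (hSD : IsSelfAdjoint SD) (hSSD : S ≤ SD)
    (hR : IsBoundedInverse SD R) (hA : IsSelfAdjoint A) (hSA : S ≤ A) :
    ∃! T, IsRelativeParameter S A R T := by
  obtain ⟨T, hT, hL⟩ := exists_operatorPart (isClosed_deficiencySpace hS 0)
    (boundaryRelation_selfAdjoint hS hreg hSD hSSD hR hA hSA)
  refine ⟨T, ⟨hT, (graph_eq_relativeGraph_iff hS hreg hSD hSSD hR hA hSA hT).2 hL⟩, ?_⟩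
  rintro T' ⟨hT', hgraph⟩
  exact eq_of_operatorPart (L := boundaryRelation S A R) hT' hT
    ((graph_eq_relativeGraph_iff hS hreg hSD hSSD hR hA hSA hT').1 hgraph) hL

/-- The components of an element of the domain of `S_T`. -/
theorem IsRelativeParameter.components (hS : Dense (S.domain : Set H))
    (hSD : IsSelfAdjoint SD) (hSSD : S ≤ SD)
    (hR : IsBoundedInverse SD R) {T : H →ₗ.[ℂ] H}
    (hT : IsRelativeParameter S A R T) {g : A.domain} {f : S.closure.domain} {u : T.domain}
    {w : coDomainSpace S T} (hg : (f : H) + R (T u + w) + u = g) :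
    A g = S.closure f + (T u + w) ∧ (u : H) = g - R (A g) ∧
      (f : H) = R (A g - deficiencyProj hS 0 (A g)) ∧ T u + w = deficiencyProj hS 0 (A g) := by
  have hcl : S.IsClosable := hSD.isClosed.isClosable.leIsClosable hSSD
  have hRf : R (S.closure f) = f :=
    hR.apply_of_mem_graph (mem_graph_of_le (closure_le_of_isClosed hSD.isClosed hSSD) f)
  have hmem : ((g : H), S.closure f + (T u + w)) ∈ A.graph := by
    have : ((g : H), S.closure f + (T u + w)) ∈ relativeGraph S R T :=
      ⟨f, u, w, hg.symm, (add_assoc _ _ _).symm⟩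
    rwa [← hT.2] at this
  have hAg : A g = S.closure f + (T u + w) := apply_eq_of_mem_graph hmem g.2
  have hproj : deficiencyProj hS 0 (A g) = T u + w := by
    rw [hAg]
    exact deficiencyProj_eq hS (Submodule.add_mem _ (hT.1.mem u).2.1 w.2.1)
      (closure_apply_mem_orthogonal hS hcl f)
  refine ⟨hAg, ?_, ?_, hproj.symm⟩
  · rw [hAg, map_add, hRf, ← hg]
    abel
  · rw [hproj, hAg, add_sub_cancel_right, hRf]

/-- `A g ± iε g` splits orthogonally into `(S̄ ± iε) f` and `2iε u`, respectively `2iε U u`. -/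
theorem IsVonNeumannParameter.components (hS : Dense (S.domain : Set H)) (hcl : S.IsClosable)
    {ε : ℝ} (hε : ε ≠ 0)
    {U : deficiencySpace S (Complex.I * ε) ≃ₗᵢ[ℂ] deficiencySpace S (-(Complex.I * ε))}
    (hU : IsVonNeumannParameter S A ε U) {g : A.domain} {f : S.closure.domain}
    {u : deficiencySpace S (Complex.I * ε)} (hg : (g : H) = f + u - U u) :
    A g = S.closure f + (Complex.I * ε) • (u : H) + (Complex.I * ε) • (U u : H) ∧
    (u : H) = (2 * Complex.I * ε)⁻¹ •
      deficiencyProj hS (Complex.I * ε) (A g + (Complex.I * ε) • (g : H)) ∧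
    (U u : H) = (2 * Complex.I * ε)⁻¹ •
      deficiencyProj hS (-(Complex.I * ε)) (A g - (Complex.I * ε) • (g : H)) := by
  have hmem : ((g : H), S.closure f + (Complex.I * ε) • (u : H) + (Complex.I * ε) • (U u : H)) ∈
      A.graph := by
    have : ((g : H), S.closure f + (Complex.I * ε) • (u : H) + (Complex.I * ε) • (U u : H)) ∈
      vonNeumannGraph S ε U := ⟨f, u, hg, rfl⟩
    rwa [← hU] at this
  have hAg := apply_eq_of_mem_graph hmem g.2
  have h2z : 2 * Complex.I * (ε : ℂ) ≠ 0 := by simp [hε]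
  refine ⟨hAg, ?_, ?_⟩
  · have horth := closure_sub_smul_mem_orthogonal hS hcl (Complex.I * ε) f
    have hsum : A g + (Complex.I * ε) • (g : H) =
        (S.closure f - (starRingEnd ℂ (Complex.I * ε)) • (f : H)) +
          (2 * Complex.I * ε) • (u : H) := by
      rw [conj_I_mul]
      change A ⟨g, g.2⟩ + _ = _
      rw [hAg, hg]
      module
    rw [hsum, deficiencyProj_eq hS (Submodule.smul_mem _ _ u.2) horth, inv_smul_smul₀ h2z]
  · have horth := closure_sub_smul_mem_orthogonal hS hcl (-(Complex.I * ε)) f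
    have hsum : A g - (Complex.I * ε) • (g : H) =
        (S.closure f - (starRingEnd ℂ (-(Complex.I * ε))) • (f : H)) +
          (2 * Complex.I * ε) • (U u : H) := by
      rw [map_neg, conj_I_mul, neg_neg]
      change A ⟨g, g.2⟩ - _ = _
      rw [hAg, hg]
      module
    rw [hsum, deficiencyProj_eq hS (Submodule.smul_mem _ _ (U u).2) horth, inv_smul_smul₀ h2z]

/-- The quantitative estimate behind the limits: the component of `g` in the domain of the closure
at the spectral point `iε` is `O(ε)`-close to the one at the spectral point `0`. -/
theorem norm_closure_sub_le (hS : Dense (S.domain : Set H)) (hcl : S.IsClosable)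
    (hsymm : S.closure.IsFormalAdjoint S.closure) {c : ℝ} (hc : 0 < c)
    (hreg : ∀ f : S.closure.domain, c * ‖(f : H)‖ ≤ ‖S.closure f‖) {ε : ℝ} (hε : 0 < ε)
    (hε1 : ε ≤ 1) {a g n u : H} {f f' : S.closure.domain} (hn : n ∈ deficiencySpace S 0)
    (ha : a = S.closure f + n) (hu : u ∈ deficiencySpace S (Complex.I * ε))
    (ha' : a + (Complex.I * ε) • g =
      S.closure f' + (Complex.I * ε) • (f' : H) + (2 * Complex.I * ε) • u) :
    ‖S.closure f' - S.closure f‖ ≤ (‖g‖ + 2 * (‖a‖ + ‖g‖) / c) * ε := by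
  set M : ℝ := ‖a‖ + ‖g‖ with hM
  have hnz : ‖Complex.I * (ε : ℂ)‖ = ε := by simp [abs_of_pos hε]
  have hlhs : ‖a + (Complex.I * ε) • g‖ ≤ M := by
    refine (norm_add_le _ _).trans ?_
    rw [norm_smul, hnz]
    nlinarith [norm_nonneg g]
  have horth : inner ℂ (S.closure f' + (Complex.I * ε) • (f' : H))
      ((2 * Complex.I * ε) • u) = 0 := by
    have h := closure_sub_smul_mem_orthogonal hS hcl (Complex.I * ε) f'
    rw [conj_I_mul, neg_smul, sub_neg_eq_add] at h
    exact Submodule.inner_left_of_mem_orthogonal (Submodule.smul_mem _ _ hu) h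
  -- Pythagoras bounds `S̄ f'` and `2iε u` by `M` uniformly in `ε ≤ 1`.
  have hpyth : ‖a + (Complex.I * ε) • g‖ * ‖a + (Complex.I * ε) • g‖ =
      ‖S.closure f' + (Complex.I * ε) • (f' : H)‖ * ‖S.closure f' + (Complex.I * ε) • (f' : H)‖ +
        ‖(2 * Complex.I * ε) • u‖ * ‖(2 * Complex.I * ε) • u‖ := by
    rw [ha']
    exact norm_add_sq_eq_norm_sq_add_norm_sq_of_inner_eq_zero _ _ horth
  have hsq : ‖S.closure f' + (Complex.I * ε) • (f' : H)‖ ^ 2 =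
      ‖S.closure f'‖ ^ 2 + ε ^ 2 * ‖(f' : H)‖ ^ 2 := by
    have h := norm_sub_I_mul_smul_sq hsymm (-ε) f'
    rw [neg_sq] at h
    rw [← h]
    congr 2
    push_cast
    module
  have hM0 : 0 ≤ M := by positivity
  have hMsq : ‖a + (Complex.I * ε) • g‖ * ‖a + (Complex.I * ε) • g‖ ≤ M * M :=
    mul_le_mul hlhs hlhs (norm_nonneg _) hM0
  have hS' : ‖S.closure f'‖ ≤ M := by
    refine le_of_sq_le_sq ?_ hM0
    have : 0 ≤ ε ^ 2 * ‖(f' : H)‖ ^ 2 := by positivity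
    nlinarith [mul_self_nonneg ‖(2 * Complex.I * ε) • u‖]
  have hu' : ‖(2 * Complex.I * ε) • u‖ ≤ M := by
    refine le_of_sq_le_sq ?_ hM0
    nlinarith [mul_self_nonneg ‖S.closure f' + (Complex.I * ε) • (f' : H)‖]
  have hf' : ‖(f' : H)‖ ≤ M / c := by
    rw [le_div_iff₀' hc]
    exact (hreg f').trans hS'
  set d : H := S.closure f' - S.closure f with hd
  have hdk : S.closure (f' - f) = d := LinearPMap.map_sub _ _ _
  have hk : ‖((f' - f : S.closure.domain) : H)‖ ≤ ‖d‖ / c := by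
    rw [le_div_iff₀' hc, ← hdk]
    exact hreg _
  have hdn : inner ℂ d n = 0 := by
    rw [← hdk]
    exact Submodule.inner_left_of_mem_orthogonal hn (closure_apply_mem_orthogonal hS hcl _)
  -- Moving `S̄` across as `S* u = iε u` gains the decisive factor `ε`.
  have hdu : inner ℂ d ((2 * Complex.I * ε) • u) =
      (Complex.I * ε) * inner ℂ ((f' - f : S.closure.domain) : H) ((2 * Complex.I * ε) • u) := by
    rw [← hdk, inner_smul_right, inner_closure_left hS hcl (mem_deficiencySpace.1 hu),
      inner_smul_right, inner_smul_right]
    ring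
  have hdd : inner ℂ d d = (Complex.I * ε) * inner ℂ d (g - f') -
      (Complex.I * ε) * inner ℂ ((f' - f : S.closure.domain) : H) ((2 * Complex.I * ε) • u) := by
    have hexp : d = n + (Complex.I * ε) • (g - f') - (2 * Complex.I * ε) • u := by
      rw [ha] at ha'
      rw [hd]
      linear_combination (norm := module) -ha'
    nth_rewrite 2 [hexp]
    rw [inner_sub_right, inner_add_right, hdn, hdu, inner_smul_right, zero_add]
  have hnorm : ‖d‖ * ‖d‖ ≤ (‖g‖ + 2 * M / c) * ε * ‖d‖ := by
    have h1 : ‖d‖ * ‖d‖ = ‖inner ℂ d d‖ := by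
      rw [inner_self_eq_norm_sq_to_K]
      simp [sq]
    have h2 : ‖inner ℂ d (g - f')‖ ≤ ‖d‖ * (‖g‖ + M / c) := by
      refine (norm_inner_le_norm _ _).trans ?_
      gcongr
      exact (norm_sub_le _ _).trans (by gcongr)
    have h3 : ‖inner ℂ ((f' - f : S.closure.domain) : H) ((2 * Complex.I * ε) • u)‖ ≤
        ‖d‖ / c * M := by
      refine (norm_inner_le_norm _ _).trans ?_
      gcongr
    rw [h1, hdd]
    refine (norm_sub_le _ _).trans ?_
    rw [norm_mul (Complex.I * (ε : ℂ)), norm_mul (Complex.I * (ε : ℂ)), hnz]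
    have h4 := mul_le_mul_of_nonneg_left h2 hε.le
    have h5 := mul_le_mul_of_nonneg_left h3 hε.le
    have h6 : (‖g‖ + 2 * M / c) * ε * ‖d‖ =
        ε * (‖d‖ * (‖g‖ + M / c)) + ε * (‖d‖ / c * M) := by
      field_simp
      ring
    rw [h6]
    exact add_le_add h4 h5
  -- `hnorm` is quadratic in `‖d‖`; one factor is cancelled unless it is zero.
  rcases (norm_nonneg d).eq_or_lt with h0 | hpos
  · rw [← h0]
    positivity
  · exact le_of_mul_le_mul_right hnorm hpos

end

end RelativeParameter

/-! ### Passing to the limit `ε ↓ 0` -/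

section Limits

variable {H : Type*} [NormedAddCommGroup H] [InnerProductSpace ℂ H]

theorem eventually_le_one_towardsZero : ∀ᶠ ε : Set.Ioi (0 : ℝ) in towardsZero, (ε : ℝ) ≤ 1 := by
  have h : ∀ᶠ t : ℝ in 𝓝[>] (0 : ℝ), t ≤ 1 := by
    filter_upwards [Ioo_mem_nhdsGT (zero_lt_one (α := ℝ))] with t ht using ht.2.le
  exact h.comap Subtype.val

/-- Uses `√(a² + b²) ≤ a + b` for nonnegative `a`, `b`. -/
theorem EqAddBigOGraph.of_mem_graph {A : H →ₗ.[ℂ] H} {x x' : Set.Ioi (0 : ℝ) → H} {y y' : H}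
    (hx : ∀ ε, (x ε, x' ε) ∈ A.graph) (hy : (y, y') ∈ A.graph) (h : EqAddBigO x y)
    (h' : EqAddBigO x' y') : EqAddBigOGraph A x y := by
  refine ⟨fun ε => LinearPMap.mem_domain_of_mem_graph (hx ε),
    LinearPMap.mem_domain_of_mem_graph hy, ?_⟩
  refine IsBigO.trans (IsBigO.of_bound 1 (Eventually.of_forall fun ε => ?_))
    (h.norm_left.add h'.norm_left)
  rw [graphNorm, LinearPMap.map_sub, apply_eq_of_mem_graph (hx ε), apply_eq_of_mem_graph hy,
    one_mul, Real.norm_of_nonneg (Real.sqrt_nonneg _), Real.norm_of_nonneg (by positivity)]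
  refine Real.sqrt_le_iff.2 ⟨by positivity, ?_⟩
  have := mul_nonneg (norm_nonneg (x ε - y)) (norm_nonneg (x' ε - y'))
  change ‖x ε - y‖ ^ 2 + _ ≤ _
  nlinarith

variable [CompleteSpace H]

theorem adjoint_toAdjointDomain (S : H →ₗ.[ℂ] H) (z : ℂ) (u : deficiencySpace S z) :
    S† (toAdjointDomain S z u) = z • (u : H) :=
  apply_eq_of_mem_graph (mem_deficiencySpace.1 u.2) (deficiencySpace_le_domain S z u.2)

end Limits

end ExtensionTheory

end

/-! ### The main theorem -/

open ExtensionTheory in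
theorem mainTheorem3 {H : Type*} [NormedAddCommGroup H] [InnerProductSpace ℂ H] [CompleteSpace H]
    (S : H →ₗ.[ℂ] H) (hdense : Dense (S.domain : Set H)) (hsymm : S.IsFormalAdjoint S)
    (hreg : IsRegularTypePoint S.closure 0) (hdef : deficiencySpace S 0 ≠ ⊥)
    -- the distinguished extension and its inverse
    (SD : H →ₗ.[ℂ] H) (hSD : IsSelfAdjoint SD) (hSSD : S ≤ SD)
    (R : H →L[ℂ] H) (hR : IsBoundedInverse SD R)
    -- the self-adjoint extension under consideration
    (A : H →ₗ.[ℂ] H) (hA : IsSelfAdjoint A) (hSA : S ≤ A) :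
    -- the extension parameters are well defined
    (∀ ε : Set.Ioi (0 : ℝ), ∃! U, IsVonNeumannParameter S A (ε : ℝ) U) ∧
    (∃! T, IsRelativeParameter S A R T) ∧
    ∀ (U : ∀ ε : Set.Ioi (0 : ℝ), deficiencySpace S (Complex.I * (ε : ℝ)) ≃ₗᵢ[ℂ]
          deficiencySpace S (-(Complex.I * (ε : ℝ))))
      (_ : ∀ ε : Set.Ioi (0 : ℝ), IsVonNeumannParameter S A (ε : ℝ) (U ε))
      (T : H →ₗ.[ℂ] H) (_ : IsRelativeParameter S A R T) (g : A.domain),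
      -- the components of `g` exist and are uniquely determined
      (∃! p : S.closure.domain × T.domain × coDomainSpace S T,
        (p.1 : H) + R (T p.2.1 + p.2.2) + p.2.1 = g) ∧
      (∀ ε : Set.Ioi (0 : ℝ),
        ∃! p : S.closure.domain × deficiencySpace S (Complex.I * (ε : ℝ)),
          (g : H) = p.1 + p.2 - U ε p.2) ∧
      ∀ (f : S.closure.domain) (u : T.domain) (w : coDomainSpace S T)
        (_ : (f : H) + R (T u + w) + u = g)
        (fe : Set.Ioi (0 : ℝ) → S.closure.domain)
        (ue : ∀ ε : Set.Ioi (0 : ℝ), deficiencySpace S (Complex.I * (ε : ℝ)))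
        (_ : ∀ ε, (g : H) = fe ε + ue ε - U ε (ue ε)),
        -- explicit formulas for the components
        (∀ ε : Set.Ioi (0 : ℝ), (ue ε : H) = (2 * Complex.I * (ε : ℝ))⁻¹ •
          deficiencyProj hdense (Complex.I * (ε : ℝ)) (A g + (Complex.I * (ε : ℝ)) • (g : H))) ∧
        (∀ ε : Set.Ioi (0 : ℝ), (U ε (ue ε) : H) = (2 * Complex.I * (ε : ℝ))⁻¹ •
          deficiencyProj hdense (-(Complex.I * (ε : ℝ)))
            (A g - (Complex.I * (ε : ℝ)) • (g : H))) ∧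
        (u : H) = g - R (A g) ∧
        (f : H) = R (A g - deficiencyProj hdense 0 (A g)) ∧
        T u + w = deficiencyProj hdense 0 (A g) ∧
        -- limits in the norm of the Hilbert space
        EqAddBigO (fun ε => ((ue ε : H) - U ε (ue ε)) -
          R (S† (toAdjointDomain S _ (ue ε) - toAdjointDomain S _ (U ε (ue ε))))) (u : H) ∧
        EqAddBigO (fun ε => (2 * Complex.I * (ε : ℝ)) • (ue ε : H)) (T u + w) ∧
        EqAddBigO (fun ε => (2 * Complex.I * (ε : ℝ)) • (U ε (ue ε) : H)) (T u + w) ∧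
        EqAddBigO (fun ε => (ue ε : H) - U ε (ue ε)) (R (T u + w) + u) ∧
        EqAddBigO (fun ε => (Complex.I * (ε : ℝ)) • (ue ε : H) +
          (Complex.I * (ε : ℝ)) • (U ε (ue ε) : H)) (T u + w) ∧
        EqAddBigO (fun ε => (fe ε : H)) (f : H) ∧
        EqAddBigO (fun ε => S.closure (fe ε)) (S.closure f) ∧
        -- limits in the graph norms
        EqAddBigOGraph A (fun ε => (ue ε : H) - U ε (ue ε)) (R (T u + w) + u) ∧
        EqAddBigOGraph A (fun ε => (fe ε : H)) (f : H) ∧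
        EqAddBigOGraph S† (fun ε => (ue ε : H) - U ε (ue ε)) (R (T u + w) + u) ∧
        EqAddBigOGraph S† (fun ε => (fe ε : H)) (f : H) := by
  have hcl : S.IsClosable := hA.isClosed.isClosable.leIsClosable hSA
  have hleA := closure_le_of_isClosed hA.isClosed hSA
  have hleD := closure_le_of_isClosed hSD.isClosed hSSD
  have hAadj := le_adjoint_of_le hdense hA.isFormalAdjoint_self hSA
  have hne : ∀ ε : Set.Ioi (0 : ℝ), (ε : ℝ) ≠ 0 := fun ε => ne_of_gt ε.2
  refine ⟨fun ε => ?_, existsUnique_isRelativeParameter hdense hreg hSD hSSD hR hA hSA, ?_⟩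
  · obtain ⟨U, hU⟩ := exists_isVonNeumannParameter hdense hA hSA (hne ε)
    exact ⟨U, hU, fun U' hU' => isVonNeumannParameter_unique hA (hne ε) hU' hU⟩
  intro U hU T hT g
  refine ⟨?_, fun ε => ?_, ?_⟩
  · have hg := A.mem_graph g
    rw [← SetLike.mem_coe, hT.2] at hg
    obtain ⟨f, u, w, h1, -⟩ := hg
    refine ⟨(f, u, w), h1.symm, ?_⟩
    rintro ⟨f', u', w'⟩ h'
    obtain ⟨-, hu, hf, hw⟩ := hT.components hdense hSD hSSD hR h1.symm
    obtain ⟨-, hu', hf', hw'⟩ := hT.components hdense hSD hSSD hR h'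
    obtain rfl : u' = u := Subtype.ext (hu'.trans hu.symm)
    obtain rfl : f' = f := Subtype.ext (hf'.trans hf.symm)
    obtain rfl : w' = w := Subtype.ext (add_left_cancel (hw'.trans hw.symm))
    rfl
  · have hg := A.mem_graph g
    rw [← SetLike.mem_coe, hU ε] at hg
    obtain ⟨f, u, h1, -⟩ := hg
    refine ⟨(f, u), h1, ?_⟩
    rintro ⟨f', u'⟩ h'
    obtain ⟨-, hu, -⟩ := (hU ε).components hdense hcl (hne ε) h1
    obtain ⟨-, hu', -⟩ := (hU ε).components hdense hcl (hne ε) h'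
    obtain rfl : u' = u := Subtype.ext (hu'.trans hu.symm)
    have hff : (f' : H) = f := by
      have := h'.symm.trans h1
      simpa using this
    obtain rfl : f' = f := Subtype.ext hff
    rfl
  intro f u w hg fe ue hge
  obtain ⟨hAg, hu, hf, hw⟩ := hT.components hdense hSD hSSD hR hg
  have hcomp := fun ε => (hU ε).components hdense hcl (hne ε) (hge ε)
  have hRcl : ∀ f : S.closure.domain, R (S.closure f) = f := fun f =>
    hR.apply_of_mem_graph (mem_graph_of_le hleD f)
  have hdiff : ∀ ε, (ue ε : H) - U ε (ue ε) = g - fe ε := fun ε => by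
    rw [hge ε]; abel
  have hsum : ∀ ε : Set.Ioi (0 : ℝ), (Complex.I * (ε : ℝ)) • (ue ε : H) +
      (Complex.I * (ε : ℝ)) • (U ε (ue ε) : H) = A g - S.closure (fe ε) := fun ε => by
    rw [(hcomp ε).1]; abel
  have hgf : R (T u + w) + u = g - f := by
    rw [← hg]; abel
  have hAgf : T u + w = A g - S.closure f := by
    rw [hAg]; abel
  obtain ⟨c, hc, hbound⟩ := hreg
  simp only [zero_smul, sub_zero] at hbound
  have hScl : EqAddBigO (fun ε => S.closure (fe ε)) (S.closure f) := by
    refine IsBigO.of_bound (‖(g : H)‖ + 2 * (‖A g‖ + ‖(g : H)‖) / c) ?_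
    filter_upwards [eventually_le_one_towardsZero] with ε hε
    rw [Real.norm_of_nonneg (le_of_lt ε.2)]
    refine norm_closure_sub_le hdense hcl
      (isFormalAdjoint_of_le hA.isFormalAdjoint_self hleA) hc hbound ε.2 hε
      (Submodule.add_mem _ (hT.1.mem u).2.1 w.2.1) hAg (ue ε).2 ?_
    rw [(hcomp ε).1, hge ε]
    module
  have hfe : EqAddBigO (fun ε => (fe ε : H)) (f : H) := by
    refine IsBigO.trans (IsBigO.of_bound c⁻¹ (Filter.Eventually.of_forall fun ε => ?_)) hScl
    rw [← div_eq_inv_mul, le_div_iff₀' hc, ← LinearPMap.map_sub]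
    exact hbound (fe ε - f)
  have hdiffO : EqAddBigO (fun ε => (ue ε : H) - U ε (ue ε)) (R (T u + w) + u) := by
    refine (IsBigO.neg_left hfe).congr_left fun ε => ?_
    dsimp only
    rw [hdiff, hgf]
    abel
  have hsumO : EqAddBigO (fun ε => (Complex.I * (ε : ℝ)) • (ue ε : H) +
      (Complex.I * (ε : ℝ)) • (U ε (ue ε) : H)) (T u + w) := by
    refine (IsBigO.neg_left hScl).congr_left fun ε => ?_
    dsimp only
    rw [hsum, hAgf]
    abel
  -- Since `u_ε - U u_ε` stays bounded, `iε (u_ε - U u_ε)` is `O(ε)`; adding it to or subtracting it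
  -- from `hsumO` isolates `2iε u_ε` and `2iε U u_ε`.
  have hsmulO : (fun ε : Set.Ioi (0 : ℝ) =>
      (Complex.I * (ε : ℝ)) • ((ue ε : H) - U ε (ue ε))) =O[towardsZero] fun ε => (ε : ℝ) := by
    have hbdd : (fun ε => (ue ε : H) - U ε (ue ε)) =O[towardsZero] fun _ => (1 : ℝ) := by
      have h1 : (fun ε : Set.Ioi (0 : ℝ) => (ε : ℝ)) =O[towardsZero] fun _ => (1 : ℝ) := by
        refine IsBigO.of_bound 1 ?_
        filter_upwards [eventually_le_one_towardsZero] with ε hε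
        rw [Real.norm_of_nonneg (le_of_lt ε.2)]
        simpa using hε
      have h2 := (IsBigO.trans hdiffO h1).add
        (isBigO_const_const (R (T u + w) + u) (one_ne_zero (α := ℝ)) towardsZero)
      exact h2.congr_left fun ε => sub_add_cancel _ _
    have hid : (fun ε : Set.Ioi (0 : ℝ) => Complex.I * ((ε : ℝ) : ℂ)) =O[towardsZero]
        fun ε => (ε : ℝ) :=
      IsBigO.of_bound 1 (Filter.Eventually.of_forall fun ε => by simp)
    simpa using hid.smul hbdd
  have hgraphA : ∀ ε, ((ue ε : H) - U ε (ue ε), (Complex.I * (ε : ℝ)) • (ue ε : H) +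
      (Complex.I * (ε : ℝ)) • (U ε (ue ε) : H)) ∈ A.graph := fun ε => by
    rw [hdiff, hsum]
    exact A.graph.sub_mem (A.mem_graph g) (mem_graph_of_le hleA (fe ε))
  have hgraphA' : (R (T u + w) + u, T u + w) ∈ A.graph := by
    rw [hgf, hAgf]
    exact A.graph.sub_mem (A.mem_graph g) (mem_graph_of_le hleA f)
  have hto := LinearPMap.le_graph_of_le hAadj
  refine ⟨fun ε => (hcomp ε).2.1, fun ε => (hcomp ε).2.2, hu, hf, hw, ?_, ?_, ?_, hdiffO, hsumO,
    hfe, hScl, .of_mem_graph hgraphA hgraphA' hdiffO hsumO,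
    .of_mem_graph (fun ε => mem_graph_of_le hleA (fe ε)) (mem_graph_of_le hleA f) hfe hScl,
    .of_mem_graph (fun ε => hto (hgraphA ε)) (hto hgraphA') hdiffO hsumO,
    .of_mem_graph (fun ε => hto (mem_graph_of_le hleA (fe ε))) (hto (mem_graph_of_le hleA f))
      hfe hScl⟩
  -- The error is exactly zero: `1 - R S*` annihilates `f_ε`, leaving `g - R (A g) = u`.
  · refine (isBigO_zero _ _).congr_left fun ε => ?_
    dsimp only
    rw [LinearPMap.map_sub, adjoint_toAdjointDomain, adjoint_toAdjointDomain, neg_smul,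
      sub_neg_eq_add, hsum, hdiff, map_sub, hRcl, hu]
    abel
  · refine (hsumO.add hsmulO).congr_left fun ε => ?_
    dsimp only
    module
  · refine (hsumO.sub hsmulO).congr_left fun ε => ?_
    dsimp only
    module
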